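/- Let $p$ be a prime and let $v_p$ denote the $p$-adic valuation on $\mathbb{Z}$, with $v_p(0)=\infty$. A resolution of a real number $\omega\ge 0$ is a sequence $(\gamma_i)_{i\ge 0}$ with values in $\{0\}\cup[1,\infty)$ such that $\gamma_i\ge p\,\gamma_{i+1}$ for every $i\ge 0$ and $\sum_{i\ge 0}\gamma_i=\omega$; it is an integral resolution if all the $\gamma_i$ are integers. Every non-negative integer $s$ has a unique lexicographically minimal resolution, denoted $(\widetilde\gamma_i(s))_{i\ge 0}$, and a unique lexicographically minimal integral resolution, denoted $(\widehat\gamma_i(s))_{i\ge 0}$. Theorem. Let $f,g\in\mathbb{Z}[x]$ be monic polynomials with resultant $r$, and let $s_1,s_2$ be non-negative integers such that $v_p(f(n))\ge s_1$ and $v_p(g(n))\ge s_2$ for every integer $n$. Then $$v_p(r)\ \ge\ p\sum_{i=0}^{\infty}p^i\,\widetilde\gamma_i(s_1)\,\widetilde\gamma_i(s_2)\qquad\text{and}\qquad v_p(r)\ \ge\ p\sum_{i=0}^{\infty}p^i\,\widehat\gamma_i(s_1)\,\widehat\gamma_i(s_2).$$ -/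

import Mathlib

open Polynomial
open scoped NNReal ENNReal

/-- `γ` is a (real) resolution of `ω`: its terms lie in `{0} ∪ [1, ∞)`, each term is at least
`p` times the next one, and the terms add up to `ω`. -/
structure IsResolution (p : ℕ) (ω : ℝ≥0) (γ : ℕ → ℝ≥0) : Prop where
  zero_or_one_le : ∀ i, γ i = 0 ∨ 1 ≤ γ i
  step : ∀ i, (p : ℝ≥0) * γ (i + 1) ≤ γ i
  hasSum : HasSum γ ω

/-- An integral resolution of `ω`: a resolution all of whose terms are integers. -/
structure IsIntegralResolution (p : ℕ) (ω : ℝ≥0) (γ : ℕ → ℝ≥0) : Prop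
    extends IsResolution p ω γ where
  integral : ∀ i, ∃ n : ℕ, γ i = n

/-- `γ` is the lexicographically minimal resolution of `ω`. -/
def IsMinimalResolution (p : ℕ) (ω : ℝ≥0) (γ : ℕ → ℝ≥0) : Prop :=
  IsResolution p ω γ ∧ ∀ γ', IsResolution p ω γ' → toLex γ ≤ toLex γ'

/-- `γ` is the lexicographically minimal integral resolution of `ω`. -/
def IsMinimalIntegralResolution (p : ℕ) (ω : ℝ≥0) (γ : ℕ → ℝ≥0) : Prop :=
  IsIntegralResolution p ω γ ∧ ∀ γ', IsIntegralResolution p ω γ' → toLex γ ≤ toLex γ'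

theorem IsResolution.pow_mul_le {p : ℕ} {ω : ℝ≥0} {γ : ℕ → ℝ≥0} (h : IsResolution p ω γ)
    (i j : ℕ) : (p : ℝ≥0) ^ j * γ (i + j) ≤ γ i := by
  induction j with
  | zero => simp
  | succ j ih =>
    calc (p : ℝ≥0) ^ (j + 1) * γ (i + (j + 1))
        = (p : ℝ≥0) ^ j * (p * γ (i + j + 1)) := by rw [pow_succ, mul_assoc, add_assoc]
      _ ≤ (p : ℝ≥0) ^ j * γ (i + j) := by gcongr; exact h.step _
      _ ≤ γ i := ih

theorem IsResolution.sum_pow_le {p : ℕ} {ω : ℝ≥0} {γ : ℕ → ℝ≥0} (h : IsResolution p ω γ)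
    {i : ℕ} (hi : γ i ≠ 0) : ∑ j ∈ Finset.range (i + 1), (p : ℝ≥0) ^ j ≤ ω := by
  have h1 : 1 ≤ γ i := (h.zero_or_one_le i).resolve_left hi
  calc ∑ j ∈ Finset.range (i + 1), (p : ℝ≥0) ^ j
      = ∑ j ∈ Finset.range (i + 1), (p : ℝ≥0) ^ (i + 1 - 1 - j) :=
        (Finset.sum_range_reflect (fun j => (p : ℝ≥0) ^ j) (i + 1)).symm
    _ ≤ ∑ j ∈ Finset.range (i + 1), γ j := by
        refine Finset.sum_le_sum fun j hj => ?_
        have hj' : j ≤ i := by simpa [Nat.lt_succ_iff] using hj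
        have := h.pow_mul_le j (i - j)
        rw [Nat.add_sub_cancel' hj'] at this
        calc (p : ℝ≥0) ^ (i + 1 - 1 - j) = (p : ℝ≥0) ^ (i - j) * 1 := by simp
          _ ≤ (p : ℝ≥0) ^ (i - j) * γ i := by gcongr
          _ ≤ γ j := this
    _ ≤ ω := sum_le_hasSum _ (fun _ _ => zero_le) h.hasSum

theorem exists_lt_of_not_toLex_le {a b : ℕ → ℝ≥0} (h : ¬ toLex a ≤ toLex b) :
    ∃ j, (∀ i < j, b i = a i) ∧ b j < a j :=
  not_le.1 h

/-- Every natural number has a lexicographically minimal resolution. -/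
theorem exists_isMinimalResolution (p : ℕ) [Fact p.Prime] (s : ℕ) :
    ∃ γ, IsMinimalResolution p (s : ℝ≥0) γ := by
  have hp : 1 < p := (Fact.out : p.Prime).one_lt
  have hp0 : (p : ℝ≥0) ≠ 0 := by exact_mod_cast (by omega : p ≠ 0)
  obtain ⟨N, hPN, hmax⟩ : ∃ N, ∑ i ∈ Finset.range N, p ^ i ≤ s ∧
      ∀ n, ∑ i ∈ Finset.range n, p ^ i ≤ s → n ≤ N := by
    refine ⟨Nat.findGreatest (fun N => ∑ i ∈ Finset.range N, p ^ i ≤ s) s,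
      Nat.findGreatest_spec (P := fun N => ∑ i ∈ Finset.range N, p ^ i ≤ s)
        (Nat.zero_le s) (by simp), fun n hn => Nat.le_findGreatest ?_ hn⟩
    calc n = ∑ i ∈ Finset.range n, 1 := by simp
      _ ≤ ∑ i ∈ Finset.range n, p ^ i := Finset.sum_le_sum fun i _ => Nat.one_le_pow _ _ (by omega)
      _ ≤ s := hn
  obtain ⟨D, hD⟩ : ∃ D : ℝ≥0, D = ∑ i ∈ Finset.range N, ((p : ℝ≥0) ^ i)⁻¹ := ⟨_, rfl⟩
  have hD0 : D = 0 → s = 0 := by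
    intro h
    by_contra hs
    have h1 : 1 ≤ N := hmax 1 (by simp; omega)
    have : ((p : ℝ≥0) ^ 0)⁻¹ ≤ D := hD ▸ Finset.single_le_sum
      (f := fun i => ((p : ℝ≥0) ^ i)⁻¹) (fun _ _ => zero_le) (Finset.mem_range.2 h1)
    rw [h] at this
    simp at this
  obtain ⟨c, hc⟩ : ∃ c : ℕ → ℝ≥0, c = fun i =>
      if i < N then (s : ℝ≥0) / D * ((p : ℝ≥0) ^ i)⁻¹ else 0 := ⟨_, rfl⟩
  have hres : IsResolution p s c := by
    refine ⟨fun i => ?_, fun i => ?_, ?_⟩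
    · by_cases hi : i < N
      · right
        simp only [hc, hi, if_true]
        have hDpos : 0 < D := lt_of_lt_of_le (by positivity) (hD ▸ Finset.single_le_sum
          (f := fun i => ((p : ℝ≥0) ^ i)⁻¹) (fun _ _ => zero_le) (Finset.mem_range.2 hi))
        rw [← div_eq_mul_inv, div_div, one_le_div₀ (by positivity)]
        calc D * (p : ℝ≥0) ^ i ≤ D * (p : ℝ≥0) ^ (N - 1) := by
              gcongr
              · exact_mod_cast hp.le
              · omega
          _ = ∑ j ∈ Finset.range N, (p : ℝ≥0) ^ (N - 1 - j) := by
              rw [hD, Finset.sum_mul]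
              refine Finset.sum_congr rfl fun j hj => ?_
              have hj' := Finset.mem_range.1 hj
              rw [inv_mul_eq_iff_eq_mul₀ (by positivity), ← pow_add]
              congr 1
              omega
          _ = ∑ j ∈ Finset.range N, (p : ℝ≥0) ^ j :=
              Finset.sum_range_reflect (fun j => (p : ℝ≥0) ^ j) N
          _ ≤ s := by exact_mod_cast hPN
      · left; simp [hc, hi]
    · by_cases hi : i + 1 < N
      · have hi' : i < N := by omega
        simp only [hc, hi, hi', if_true]
        apply le_of_eq
        field_simp
        ring
      · simp [hc, hi]
    · have h2 : ∑ i ∈ Finset.range N, c i = s := by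
        have : ∑ i ∈ Finset.range N, c i = (s : ℝ≥0) / D * D := by
          rw [hD, Finset.mul_sum]
          refine Finset.sum_congr rfl fun i hi => ?_
          simp [hc, Finset.mem_range.1 hi, hD]
        rw [this]
        by_cases h : D = 0
        · simp [hD0 h]
        · exact div_mul_cancel₀ _ h
      rw [← h2]
      exact hasSum_sum_of_ne_finset_zero fun i hi => by
        simp only [Finset.mem_range] at hi
        simp [hc, hi]
  refine ⟨c, hres, fun γ hγ => ?_⟩
  by_contra hlt
  obtain ⟨j, hj, hjlt⟩ := exists_lt_of_not_toLex_le hlt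
  have hle : ∀ i, γ i ≤ c i := by
    intro i
    by_cases hij : i < j
    · exact (hj i hij).le
    by_cases hiN : i < N
    · have hjN : j < N := by omega
      have h1 := hγ.pow_mul_le j (i - j)
      rw [Nat.add_sub_cancel' (not_lt.1 hij)] at h1
      have h2 : (p : ℝ≥0) ^ (i - j) * c i = c j := by
        simp only [hc, hiN, hjN, if_true]
        obtain ⟨k, rfl⟩ := Nat.exists_eq_add_of_le (not_lt.1 hij)
        rw [Nat.add_sub_cancel_left, pow_add]
        field_simp
      have h3 : (p : ℝ≥0) ^ (i - j) * γ i ≤ (p : ℝ≥0) ^ (i - j) * c i := by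
        rw [h2]; exact h1.trans hjlt.le
      exact le_of_mul_le_mul_left h3 (by positivity)
    · have : γ i = 0 := by
        by_contra h0
        have h1 := hγ.sum_pow_le h0
        have h2 := hmax (i + 1) (by exact_mod_cast h1)
        omega
      rw [this]; exact zero_le
  exact lt_irrefl (s : ℝ≥0) (NNReal.hasSum_lt hle hjlt hγ.hasSum hres.hasSum)

/-- Every natural number has a lexicographically minimal integral resolution. -/
theorem exists_isMinimalIntegralResolution (p : ℕ) [Fact p.Prime] (s : ℕ) :
    ∃ γ, IsMinimalIntegralResolution p (s : ℝ≥0) γ := by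
  have hp : 1 < p := (Fact.out : p.Prime).one_lt
  set S : Set (Lex (ℕ → ℝ≥0)) := {γ | IsIntegralResolution p (s : ℝ≥0) (ofLex γ)} with hS
  have hfin : S.Finite := by
    refine (Set.finite_range (fun a : Fin (s + 1) → Fin (s + 1) =>
      toLex (fun i : ℕ => if h : i < s + 1 then (((a ⟨i, h⟩ : Fin (s + 1)) : ℕ) : ℝ≥0)
        else 0))).subset ?_
    intro γ hγ
    have hγ' : IsIntegralResolution p (s : ℝ≥0) (ofLex γ) := hγ
    choose n hn using hγ'.integral
    have hle : ∀ i, n i < s + 1 := fun i => by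
      have := hγ'.hasSum.summable.le_tsum i (fun _ _ => zero_le)
      rw [hγ'.hasSum.tsum_eq, hn] at this
      exact Nat.lt_succ_of_le (by exact_mod_cast this)
    refine ⟨fun i => ⟨n i, hle i⟩, ?_⟩
    apply ofLex.injective
    funext i
    change (if h : i < s + 1 then ((n i : ℕ) : ℝ≥0) else 0) = ofLex γ i
    by_cases hi : i < s + 1
    · rw [dif_pos hi, hn]
    · have : ofLex γ i = 0 := by
        by_contra h0
        have h1 := hγ'.sum_pow_le h0
        have h2 : ∑ j ∈ Finset.range (i + 1), p ^ j ≤ s := by exact_mod_cast h1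
        have h3 : ∑ j ∈ Finset.range (i + 1), 1 ≤ ∑ j ∈ Finset.range (i + 1), p ^ j :=
          Finset.sum_le_sum fun j _ => Nat.one_le_pow _ _ (by omega)
        simp at h3
        omega
      rw [dif_neg hi, this]
  have hne : S.Nonempty := by
    refine ⟨toLex (fun i => if i = 0 then (s : ℝ≥0) else 0), ⟨⟨fun i => ?_, fun i => ?_, ?_⟩,
      fun i => ⟨if i = 0 then s else 0, ?_⟩⟩⟩
    · change (if i = 0 then (s : ℝ≥0) else 0) = 0 ∨ 1 ≤ (if i = 0 then (s : ℝ≥0) else 0)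
      rcases Nat.eq_zero_or_pos s with rfl | hs
      · simp
      · by_cases hi : i = 0
        · right; rw [if_pos hi]; exact_mod_cast hs
        · simp [hi]
    · change (p : ℝ≥0) * (if i + 1 = 0 then (s : ℝ≥0) else 0) ≤ _
      simp
    · exact hasSum_ite_eq 0 (s : ℝ≥0)
    · change (if i = 0 then (s : ℝ≥0) else 0) = _
      split_ifs <;> simp
  obtain ⟨γ, hγ, hmin⟩ := Set.exists_min_image S id hfin hne
  exact ⟨ofLex γ, hγ, fun γ' hγ' => hmin (toLex γ') hγ'⟩

/-- The minimal (real) resolution `i ↦ γ̃ᵢ(s)` of the natural number `s`. -/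
noncomputable def minimalResolution (p : ℕ) [Fact p.Prime] (s : ℕ) : ℕ → ℝ≥0 :=
  Classical.choose (exists_isMinimalResolution p s)

/-- The minimal integral resolution `i ↦ γ̂ᵢ(s)` of the natural number `s`. -/
noncomputable def minimalIntegralResolution (p : ℕ) [Fact p.Prime] (s : ℕ) : ℕ → ℝ≥0 :=
  Classical.choose (exists_isMinimalIntegralResolution p s)

theorem minimalResolution_spec (p : ℕ) [Fact p.Prime] (s : ℕ) :
    IsMinimalResolution p (s : ℝ≥0) (minimalResolution p s) :=
  Classical.choose_spec (exists_isMinimalResolution p s)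

theorem minimalIntegralResolution_spec (p : ℕ) [Fact p.Prime] (s : ℕ) :
    IsMinimalIntegralResolution p (s : ℝ≥0) (minimalIntegralResolution p s) :=
  Classical.choose_spec (exists_isMinimalIntegralResolution p s)

theorem IsMinimalResolution.eq {p : ℕ} {ω : ℝ≥0} {γ γ' : ℕ → ℝ≥0}
    (h : IsMinimalResolution p ω γ) (h' : IsMinimalResolution p ω γ') : γ = γ' :=
  toLex.injective (le_antisymm (h.2 _ h'.1) (h'.2 _ h.1))

theorem IsMinimalIntegralResolution.eq {p : ℕ} {ω : ℝ≥0} {γ γ' : ℕ → ℝ≥0}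
    (h : IsMinimalIntegralResolution p ω γ) (h' : IsMinimalIntegralResolution p ω γ') : γ = γ' :=
  toLex.injective (le_antisymm (h.2 _ h'.1) (h'.2 _ h.1))

/-- The `p`-adic valuation `v_p` on `ℤ`, with `v_p(0) = ⊤`. -/
noncomputable def vp (p : ℕ) (a : ℤ) : ℕ∞ := emultiplicity (p : ℤ) a

/-!
Over an algebraic closure `L` of `ℚ_[p]`, the valuation of the resultant is the sum of the
valuations of `α - β` over the roots `α` of `f` and `β` of `g`. The proof distributes these
valuations over the edges of the tree of residue classes of `ℤ` modulo powers of `p`. The edge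
leading to the class of `c` modulo `p ^ (i + 1)` receives from `α` the part of the valuation of
`α - c` that lies between `i` and `i + 1` (`rootWeight`). The edges with positive weight for both
`α` and `β` lie on one path, and along it the products of the two weights add up to at most the
valuation of `α - β` (`treeSum_rootWeight_le`). Summing over all roots, the valuation of the
resultant is at least `∑ Φ e * Γ e` over all edges `e`, where `Φ` and `Γ` are the total weights of
`f` and of `g` (`treeSum_sum_rootWeight_le`).

The weight `Φ` is integral, because its sums along paths from the root are valuations of Gauss
norms of the integral polynomials `f (c + p ^ i * X)`; these sums reach `s` because `p ^ s` divides
all values of `f`; and the weight of an edge is at least the sum of the weights of its `p` children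
(`exists_isTreeWeight`). Descending along lightest children therefore gives an integral resolution,
so that an edge from a class at which the sum `s - m` is still to be collected weighs at least the
first term of the minimal integral resolution of `s - m` (`IsTreeWeight.firstTerm_le`).

The minimal integral resolution is greedy: its first term is the least `x` with
`x + ⌊x/p⌋ + ⌊x/p²⌋ + ⋯ ≥ s`, and the remaining terms form the minimal integral resolution of
`s - x` (`isMinimalIntegralResolution_greedy`). Raising the total by one raises exactly one term by
one, from which it follows that spending more than the greedy first terms on an edge never pays off
(`greedyPairing_le_of_firstTerm_le`). An induction along the tree then bounds `∑ Φ e * Γ e` below by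
the value for weights that are constant on levels and greedy, which is the integral bound
(`IsTreeWeight.mul_greedyPairing_le_treeSum`).

The bound with real resolutions is weaker. The minimal real resolution is a geometric progression
of ratio `1/p` (`isMinimalResolution_geomResolution`), and Chebyshev's sum inequality, applied with
weights `p ^ (-i)` to the decreasing sequences `p ^ i * γ i` and `p ^ i * δ i`, shows that
its pairing is at most the pairing of any two resolutions (`geomResolution_pairing_le`).
-/

/-! ### Greedy integral resolutions -/

/-- The largest possible total `x + ⌊x/p⌋ + ⌊x/p²⌋ + ⋯` of an integral resolution with first
term `x`. By Legendre's formula it is the `p`-adic valuation of `(p * x)!`, which is taken as the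
definition. -/
def maxTotal (p x : ℕ) : ℕ := padicValNat p (p * x).factorial

/-- The smallest `x` for which some integral resolution with first term `x` has total at
least `s`. -/
noncomputable def firstTerm (p s : ℕ) : ℕ := sInf {x | s ≤ maxTotal p x}

/-- The greedy integral resolution of `s`: every term is the smallest one with which the remaining
total can still be attained. -/
noncomputable def greedy (p : ℕ) : ℕ → ℕ → ℕ
  | s, 0 => firstTerm p s
  | s, i + 1 => greedy p (s - firstTerm p s) i

/-- The sum `∑ pⁱ γᵢ(s) γᵢ(t)` formed with the greedy integral resolutions of `s` and `t`. -/
noncomputable def greedyPairing (p s t : ℕ) : ℝ≥0∞ :=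
  ∑' i : ℕ, (p : ℝ≥0∞) ^ i * (greedy p s i : ℝ≥0∞) * (greedy p t i : ℝ≥0∞)

theorem maxTotal_zero (p : ℕ) : maxTotal p 0 = 0 := by simp [maxTotal]

theorem greedyPairing_comm (p s t : ℕ) : greedyPairing p s t = greedyPairing p t s :=
  tsum_congr fun _ => mul_right_comm _ _ _

theorem greedyPairing_eq (p s t : ℕ) : greedyPairing p s t =
    firstTerm p s * firstTerm p t +
      p * greedyPairing p (s - firstTerm p s) (t - firstTerm p t) := by
  rw [greedyPairing, tsum_eq_zero_add' ENNReal.summable, greedyPairing, ← ENNReal.tsum_mul_left]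
  simp only [pow_zero, one_mul, greedy, pow_succ']
  congr 1
  exact tsum_congr fun i => by ring

section Greedy

variable (p : ℕ) [hp : Fact p.Prime]

theorem maxTotal_eq (x : ℕ) : maxTotal p x = x + maxTotal p (x / p) := by
  rw [maxTotal, padicValNat_factorial_mul, maxTotal, padicValNat_mul_div_factorial, add_comm]

theorem maxTotal_mono : Monotone (maxTotal p) := fun _ _ h =>
  (padicValNat_dvd_iff_le (Nat.factorial_ne_zero _)).1
    (pow_padicValNat_dvd.trans (Nat.factorial_dvd_factorial (Nat.mul_le_mul_left p h)))

theorem maxTotal_lt_succ (x : ℕ) : maxTotal p x < maxTotal p (x + 1) := by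
  rw [maxTotal_eq p x, maxTotal_eq p (x + 1)]
  have := maxTotal_mono p (Nat.div_le_div_right (c := p) (Nat.le_succ x))
  simp only [Nat.succ_eq_add_one] at this
  omega

theorem firstTerm_le_iff {s x : ℕ} : firstTerm p s ≤ x ↔ s ≤ maxTotal p x := by
  refine ⟨fun h => ?_, fun h => Nat.sInf_le h⟩
  have hne : {x | s ≤ maxTotal p x}.Nonempty :=
    ⟨s, by rw [Set.mem_ofPred_eq, maxTotal_eq]; exact Nat.le_add_right _ _⟩
  exact (show s ≤ maxTotal p (firstTerm p s) from Nat.sInf_mem hne).trans (maxTotal_mono p h)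

theorem firstTerm_le_self (s : ℕ) : firstTerm p s ≤ s := by
  rw [firstTerm_le_iff, maxTotal_eq]
  exact Nat.le_add_right _ _

theorem firstTerm_mono : Monotone (firstTerm p) := fun _ _ h =>
  (firstTerm_le_iff p).2 (h.trans ((firstTerm_le_iff p).1 le_rfl))

theorem firstTerm_pos {s : ℕ} (hs : 0 < s) : 0 < firstTerm p s := by
  by_contra h
  have h1 := (firstTerm_le_iff p).1 (Nat.le_of_not_lt h)
  rw [maxTotal_zero] at h1
  omega

theorem firstTerm_succ (s : ℕ) :
    firstTerm p (s + 1) = firstTerm p s ∨ firstTerm p (s + 1) = firstTerm p s + 1 := by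
  have h1 := firstTerm_mono p (Nat.le_succ s)
  have h2 : firstTerm p (s + 1) ≤ firstTerm p s + 1 := by
    rw [firstTerm_le_iff]
    exact ((firstTerm_le_iff p).1 le_rfl).trans_lt (maxTotal_lt_succ p _)
  simp only [Nat.succ_eq_add_one] at h1
  omega

theorem mul_firstTerm_sub_le (s : ℕ) : p * firstTerm p (s - firstTerm p s) ≤ firstTerm p s := by
  have h1 := (firstTerm_le_iff p (s := s)).1 le_rfl
  rw [maxTotal_eq] at h1
  have h2 : firstTerm p (s - firstTerm p s) ≤ firstTerm p s / p :=
    (firstTerm_le_iff p).2 (by omega)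
  exact (Nat.mul_le_mul_left p h2).trans (Nat.mul_div_le _ _)

theorem greedy_zero_left (i : ℕ) : greedy p 0 i = 0 := by
  have h0 : firstTerm p 0 = 0 := Nat.le_zero.1 (firstTerm_le_self p 0)
  induction i with
  | zero => exact h0
  | succ i ih => rw [greedy, h0]; exact ih

theorem mul_greedy_succ_le (s i : ℕ) : p * greedy p s (i + 1) ≤ greedy p s i := by
  induction i generalizing s with
  | zero => exact mul_firstTerm_sub_le p s
  | succ i ih => exact ih _

theorem hasSum_greedy (s : ℕ) : HasSum (fun i => (greedy p s i : ℝ≥0)) (s : ℝ≥0) := by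
  induction s using Nat.strong_induction_on with
  | _ s ih =>
    rcases Nat.eq_zero_or_pos s with rfl | hs
    · simp [greedy_zero_left]
    · have h1 := firstTerm_pos p hs
      have h2 := firstTerm_le_self p s
      have h3 := ih (s - firstTerm p s) (by omega)
      have h4 := (NNReal.hasSum_nat_add_iff (f := fun i => (greedy p s i : ℝ≥0)) 1).1 h3
      rw [Finset.sum_range_one, greedy, ← Nat.cast_add, Nat.sub_add_cancel h2] at h4
      exact h4

theorem isIntegralResolution_greedy (s : ℕ) :
    IsIntegralResolution p s (fun i => (greedy p s i : ℝ≥0)) where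
  zero_or_one_le i := by
    rcases Nat.eq_zero_or_pos (greedy p s i) with h | h
    · left; simp [h]
    · right; exact_mod_cast h
  step i := by exact_mod_cast mul_greedy_succ_le p s i
  hasSum := hasSum_greedy p s
  integral i := ⟨_, rfl⟩

theorem sum_le_maxTotal {n : ℕ → ℕ} (hn : ∀ i, p * n (i + 1) ≤ n i) (k : ℕ) :
    ∑ i ∈ Finset.range k, n i ≤ maxTotal p (n 0) := by
  induction k generalizing n with
  | zero => simp
  | succ k ih =>
    rw [Finset.sum_range_succ', maxTotal_eq, add_comm]
    gcongr
    refine (ih (n := fun i => n (i + 1)) fun i => hn (i + 1)).trans (maxTotal_mono p ?_)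
    rw [Nat.le_div_iff_mul_le hp.out.pos, mul_comm]
    exact hn 0

theorem firstTerm_le_of_hasSum {n : ℕ → ℕ} (hn : ∀ i, p * n (i + 1) ≤ n i) {s : ℕ}
    (hs : HasSum (fun i => (n i : ℝ≥0)) s) : firstTerm p s ≤ n 0 := by
  rw [firstTerm_le_iff]
  have h : (s : ℝ≥0) ≤ maxTotal p (n 0) := le_of_tendsto' hs.tendsto_sum_nat fun k => by
    exact_mod_cast sum_le_maxTotal p hn k
  exact_mod_cast h

theorem greedy_le_of_eq {n : ℕ → ℕ} (hn : ∀ i, p * n (i + 1) ≤ n i) {s : ℕ}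
    (hs : HasSum (fun i => (n i : ℝ≥0)) s) {j : ℕ} (hj : ∀ i < j, n i = greedy p s i) :
    greedy p s j ≤ n j := by
  induction j generalizing n s with
  | zero => exact firstTerm_le_of_hasSum p hn hs
  | succ j ih =>
    refine ih (n := fun i => n (i + 1)) (fun i => hn (i + 1)) ?_ fun i hi => hj (i + 1) (by omega)
    rw [NNReal.hasSum_nat_add_iff (f := fun i => (n i : ℝ≥0)) 1, Finset.sum_range_one,
      hj 0 (by omega), greedy, ← Nat.cast_add, Nat.sub_add_cancel (firstTerm_le_self p s)]
    exact hs

theorem isMinimalIntegralResolution_greedy (s : ℕ) :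
    IsMinimalIntegralResolution p s (fun i => (greedy p s i : ℝ≥0)) := by
  refine ⟨isIntegralResolution_greedy p s, fun γ hγ => ?_⟩
  by_contra hlt
  obtain ⟨j, hj, hjlt⟩ := exists_lt_of_not_toLex_le hlt
  choose n hn using hγ.integral
  obtain rfl : γ = fun i => (n i : ℝ≥0) := funext hn
  have hstep : ∀ i, p * n (i + 1) ≤ n i := fun i => by exact_mod_cast hγ.step i
  have heq : ∀ i < j, n i = greedy p s i := fun i hi => Nat.cast_injective (hj i hi)
  exact (greedy_le_of_eq p hstep hγ.hasSum heq).not_gt (Nat.cast_lt.1 hjlt)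

theorem minimalIntegralResolution_eq_greedy (s : ℕ) :
    minimalIntegralResolution p s = fun i => (greedy p s i : ℝ≥0) :=
  (minimalIntegralResolution_spec p s).eq (isMinimalIntegralResolution_greedy p s)

/-! ### The pairing of two greedy resolutions -/

theorem greedyPairing_zero_left (t : ℕ) : greedyPairing p 0 t = 0 := by
  simp [greedyPairing, greedy_zero_left]

/-- Raising the total by one raises a single term of the greedy resolution, by one; its index `j`
contributes `pʲ γⱼ(t) ≤ γ₀(t)` to the pairing. -/
theorem greedyPairing_succ_le (s t : ℕ) :
    greedyPairing p (s + 1) t ≤ greedyPairing p s t + firstTerm p t := by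
  induction s using Nat.strong_induction_on generalizing t with
  | _ s ih =>
    rw [greedyPairing_eq p (s + 1) t, greedyPairing_eq p s t]
    rcases firstTerm_succ p s with h | h
    · have h1 := firstTerm_pos p (Nat.succ_pos s)
      rw [Nat.succ_eq_add_one, h] at h1
      have h2 := firstTerm_le_self p s
      rw [h, show s + 1 - firstTerm p s = s - firstTerm p s + 1 by omega, add_assoc]
      gcongr
      calc (p : ℝ≥0∞) * greedyPairing p (s - firstTerm p s + 1) (t - firstTerm p t)
          ≤ p * (greedyPairing p (s - firstTerm p s) (t - firstTerm p t) +
              firstTerm p (t - firstTerm p t)) := by gcongr; exact ih _ (by omega) _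
        _ = p * greedyPairing p (s - firstTerm p s) (t - firstTerm p t) +
              ((p * firstTerm p (t - firstTerm p t) : ℕ) : ℝ≥0∞) := by push_cast; ring
        _ ≤ _ := by gcongr; exact mul_firstTerm_sub_le p t
    · rw [h, Nat.add_sub_add_right]
      push_cast
      apply le_of_eq
      ring

theorem greedyPairing_add_le (s t m : ℕ) :
    greedyPairing p (s + m) t ≤ greedyPairing p s t + m * firstTerm p t := by
  induction m with
  | zero => simp
  | succ m ih =>
    calc greedyPairing p (s + m + 1) t ≤ greedyPairing p (s + m) t + firstTerm p t :=
          greedyPairing_succ_le p _ _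
      _ ≤ greedyPairing p s t + m * firstTerm p t + firstTerm p t := by gcongr
      _ = _ := by push_cast; ring

theorem mul_greedyPairing_add_le {t y : ℕ} (ht : p * firstTerm p t ≤ y) (s m : ℕ) :
    (p : ℝ≥0∞) * greedyPairing p (s + m) t ≤ p * greedyPairing p s t + m * y :=
  calc (p : ℝ≥0∞) * greedyPairing p (s + m) t
      ≤ p * (greedyPairing p s t + m * firstTerm p t) := by
        gcongr
        exact greedyPairing_add_le p s t m
    _ = p * greedyPairing p s t + m * ((p * firstTerm p t : ℕ) : ℝ≥0∞) := by push_cast; ring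
    _ ≤ p * greedyPairing p s t + m * y := by gcongr

/-- First terms larger than the greedy ones, followed by greedy resolutions of the remaining
totals, never give a smaller value than the greedy resolutions. -/
theorem greedyPairing_le_of_firstTerm_le {s t a b : ℕ} (ha : firstTerm p s ≤ a)
    (hb : firstTerm p t ≤ b) :
    greedyPairing p s t ≤ a * b + p * greedyPairing p (s - a) (t - b) := by
  obtain ⟨m, hm, hma⟩ : ∃ m, s - firstTerm p s = s - a + m ∧ firstTerm p s + m ≤ a :=
    ⟨s - firstTerm p s - (s - a), by omega, by omega⟩
  obtain ⟨n, hn, hnb⟩ : ∃ n, t - firstTerm p t = t - b + n ∧ firstTerm p t + n ≤ b :=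
    ⟨t - firstTerm p t - (t - b), by omega, by omega⟩
  have hsa : p * firstTerm p (s - a) ≤ a :=
    ((Nat.mul_le_mul_left p (firstTerm_mono p (by omega))).trans (mul_firstTerm_sub_le p s)).trans
      ha
  calc greedyPairing p s t
      = firstTerm p s * firstTerm p t + p * greedyPairing p (s - a + m) (t - firstTerm p t) := by
        rw [greedyPairing_eq, hm]
    _ ≤ firstTerm p s * firstTerm p t +
          (p * greedyPairing p (s - a) (t - b + n) + m * firstTerm p t) := by
        rw [← hn]
        gcongr
        exact mul_greedyPairing_add_le p (mul_firstTerm_sub_le p t) _ _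
    _ ≤ firstTerm p s * firstTerm p t +
          (p * greedyPairing p (t - b) (s - a) + n * a + m * firstTerm p t) := by
        rw [greedyPairing_comm p (s - a)]
        gcongr
        exact mul_greedyPairing_add_le p hsa _ _
    _ = ((firstTerm p s + m : ℕ) * firstTerm p t + a * n) +
          p * greedyPairing p (s - a) (t - b) := by
        rw [greedyPairing_comm p (s - a)]
        push_cast
        ring
    _ ≤ (a * firstTerm p t + a * n) + p * greedyPairing p (s - a) (t - b) := by gcongr
    _ = a * (firstTerm p t + n : ℕ) + p * greedyPairing p (s - a) (t - b) := by
        push_cast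
        ring
    _ ≤ a * b + p * greedyPairing p (s - a) (t - b) := by gcongr

end Greedy

/-! ### The minimal real resolution -/

/-- The largest number of non-zero terms that a resolution of `s` can have. -/
def maxLength (p s : ℕ) : ℕ := Nat.findGreatest (fun N => ∑ i ∈ Finset.range N, p ^ i ≤ s) s

/-- The sum `1 + p⁻¹ + ⋯ + p⁻⁽ᴺ⁻¹⁾`. -/
noncomputable def invGeomSum (p N : ℕ) : ℝ≥0 := ∑ i ∈ Finset.range N, ((p : ℝ≥0) ^ i)⁻¹

/-- The resolution of `s` that is a geometric progression of ratio `p⁻¹` and of the largest possible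
length. -/
noncomputable def geomResolution (p s i : ℕ) : ℝ≥0 :=
  if i < maxLength p s then s / invGeomSum p (maxLength p s) * ((p : ℝ≥0) ^ i)⁻¹ else 0

section RealResolution

variable (p : ℕ) [hp : Fact p.Prime]

theorem le_maxLength_iff {s n : ℕ} : n ≤ maxLength p s ↔ ∑ i ∈ Finset.range n, p ^ i ≤ s := by
  constructor
  · intro h
    have h1 := Nat.findGreatest_spec (P := fun N => ∑ i ∈ Finset.range N, p ^ i ≤ s)
      (Nat.zero_le s) (by simp)
    exact (Finset.sum_le_sum_of_subset (Finset.range_mono h)).trans h1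
  · intro h
    refine Nat.le_findGreatest ?_ h
    calc n = ∑ i ∈ Finset.range n, 1 := by simp
      _ ≤ ∑ i ∈ Finset.range n, p ^ i := Finset.sum_le_sum fun i _ => Nat.one_le_pow _ _ hp.out.pos
      _ ≤ s := h

theorem IsResolution.lt_maxLength {p : ℕ} [Fact p.Prime] {s : ℕ} {γ : ℕ → ℝ≥0}
    (h : IsResolution p s γ) {i : ℕ} (hi : γ i ≠ 0) : i < maxLength p s := by
  rw [← Nat.succ_le_iff, le_maxLength_iff]
  exact_mod_cast h.sum_pow_le hi

theorem IsResolution.sum_range_eq {p : ℕ} [Fact p.Prime] {s : ℕ} {γ : ℕ → ℝ≥0}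
    (h : IsResolution p s γ) {M : ℕ} (hM : maxLength p s ≤ M) :
    ∑ i ∈ Finset.range M, γ i = s := by
  refine (hasSum_sum_of_ne_finset_zero fun i hi => ?_).unique h.hasSum
  by_contra h0
  exact hi (Finset.mem_range.2 ((h.lt_maxLength h0).trans_le hM))

omit hp in
theorem invGeomSum_pos {N : ℕ} (hN : N ≠ 0) : 0 < invGeomSum p N := by
  obtain ⟨N, rfl⟩ := Nat.exists_eq_succ_of_ne_zero hN
  rw [invGeomSum, Finset.sum_range_succ']
  simp

theorem invGeomSum_succ_mul_pow (N : ℕ) :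
    invGeomSum p (N + 1) * (p : ℝ≥0) ^ N = ∑ i ∈ Finset.range (N + 1), (p : ℝ≥0) ^ i := by
  have hp0 : (p : ℝ≥0) ≠ 0 := by exact_mod_cast hp.out.ne_zero
  rw [← Finset.sum_range_reflect (fun j => (p : ℝ≥0) ^ j), invGeomSum, Finset.sum_mul]
  refine Finset.sum_congr rfl fun j hj => ?_
  have hj' := Finset.mem_range.1 hj
  rw [inv_mul_eq_iff_eq_mul₀ (by positivity), ← pow_add]
  congr 1
  omega

theorem maxLength_ne_zero {s : ℕ} (hs : s ≠ 0) : maxLength p s ≠ 0 := by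
  have : 1 ≤ maxLength p s := by
    rw [le_maxLength_iff]
    simpa using Nat.one_le_iff_ne_zero.2 hs
  omega

theorem isResolution_geomResolution (s : ℕ) : IsResolution p s (geomResolution p s) := by
  have hp1 : (1 : ℝ≥0) ≤ p := by exact_mod_cast hp.out.one_le
  have hp0 : (p : ℝ≥0) ≠ 0 := by exact_mod_cast hp.out.ne_zero
  refine ⟨fun i => ?_, fun i => ?_, ?_⟩
  · by_cases hi : i < maxLength p s
    · right
      obtain ⟨N, hN⟩ := Nat.exists_eq_succ_of_ne_zero (Nat.ne_zero_of_lt hi)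
      have hD := invGeomSum_pos p (Nat.succ_ne_zero N)
      rw [geomResolution, if_pos hi, ← div_eq_mul_inv, div_div, hN, one_le_div₀ (by positivity)]
      calc invGeomSum p (N + 1) * (p : ℝ≥0) ^ i ≤ invGeomSum p (N + 1) * (p : ℝ≥0) ^ N := by
            gcongr
            omega
        _ = ∑ j ∈ Finset.range (N + 1), (p : ℝ≥0) ^ j := invGeomSum_succ_mul_pow p N
        _ ≤ s := by exact_mod_cast (le_maxLength_iff p).1 hN.ge
    · left
      rw [geomResolution, if_neg hi]
  · by_cases hi : i + 1 < maxLength p s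
    · rw [geomResolution, if_pos hi, geomResolution, if_pos (by omega)]
      apply le_of_eq
      rw [pow_succ]
      field_simp
    · rw [geomResolution, if_neg hi]
      simp
  · have h : ∑ i ∈ Finset.range (maxLength p s), geomResolution p s i = s := by
      rcases eq_or_ne s 0 with rfl | hs
      · simp [geomResolution]
      · rw [← div_mul_cancel₀ (s : ℝ≥0) (invGeomSum_pos p (maxLength_ne_zero p hs)).ne',
          invGeomSum, Finset.mul_sum]
        refine Finset.sum_congr rfl fun i hi => ?_
        rw [geomResolution, if_pos (Finset.mem_range.1 hi), invGeomSum]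
    have hsum : HasSum (geomResolution p s) _ :=
      hasSum_sum_of_ne_finset_zero (s := Finset.range (maxLength p s))
        fun i hi => if_neg (by simpa using hi)
    rwa [h] at hsum

/-- If a resolution first differs from the geometric one by a smaller term at index `j`, then all
its terms from `j` on are bounded by the geometric ones, so that its total is too small. -/
theorem isMinimalResolution_geomResolution (s : ℕ) :
    IsMinimalResolution p s (geomResolution p s) := by
  have hp0 : (p : ℝ≥0) ≠ 0 := by exact_mod_cast hp.out.ne_zero
  have hres := isResolution_geomResolution p s
  refine ⟨hres, fun γ hγ => ?_⟩
  by_contra hlt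
  obtain ⟨j, hj, hjlt⟩ := exists_lt_of_not_toLex_le hlt
  have hle : ∀ i, γ i ≤ geomResolution p s i := by
    intro i
    by_cases hij : i < j
    · exact (hj i hij).le
    by_cases hi : γ i = 0
    · rw [hi]
      exact zero_le
    obtain ⟨k, rfl⟩ := Nat.exists_eq_add_of_le (not_lt.1 hij)
    have hN := hγ.lt_maxLength hi
    have h1 : (p : ℝ≥0) ^ k * geomResolution p s (j + k) = geomResolution p s j := by
      rw [geomResolution, if_pos hN, geomResolution, if_pos (by omega), pow_add]
      field_simp
    refine le_of_mul_le_mul_left (a := (p : ℝ≥0) ^ k) ?_ (by positivity)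
    rw [h1]
    exact (hγ.pow_mul_le j k).trans hjlt.le
  exact lt_irrefl (s : ℝ≥0) (NNReal.hasSum_lt hle hjlt hγ.hasSum hres.hasSum)

theorem minimalResolution_eq_geomResolution (s : ℕ) :
    minimalResolution p s = geomResolution p s :=
  (minimalResolution_spec p s).eq (isMinimalResolution_geomResolution p s)

/-! ### Comparison of the real with the integral resolutions -/

omit hp in
/-- Chebyshev's sum inequality with weights. -/
theorem sum_mul_sum_le_of_antitone {w x y : ℕ → ℝ} (hw : ∀ i, 0 ≤ w i) (hx : Antitone x)
    (hy : Antitone y) (S : Finset ℕ) :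
    (∑ i ∈ S, w i * x i) * ∑ i ∈ S, w i * y i ≤
      (∑ i ∈ S, w i) * ∑ i ∈ S, w i * (x i * y i) := by
  have h : 0 ≤ ∑ i ∈ S, ∑ j ∈ S, w i * w j * ((x i - x j) * (y i - y j)) := by
    refine Finset.sum_nonneg fun i _ => Finset.sum_nonneg fun j _ =>
      mul_nonneg (mul_nonneg (hw i) (hw j)) ?_
    rcases le_total i j with hij | hij
    · exact mul_nonneg (sub_nonneg.2 (hx hij)) (sub_nonneg.2 (hy hij))
    · exact mul_nonneg_of_nonpos_of_nonpos (sub_nonpos.2 (hx hij)) (sub_nonpos.2 (hy hij))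
  have h2 : ∑ i ∈ S, ∑ j ∈ S, w i * w j * ((x i - x j) * (y i - y j)) =
      2 * ((∑ i ∈ S, w i) * ∑ i ∈ S, w i * (x i * y i) -
        (∑ i ∈ S, w i * x i) * ∑ i ∈ S, w i * y i) := by
    have e : ∀ i j, w i * w j * ((x i - x j) * (y i - y j)) =
        w i * (x i * y i) * w j + w i * (w j * (x j * y j)) -
          (w i * x i * (w j * y j) + w i * y i * (w j * x j)) := fun i j => by ring
    simp only [e, Finset.sum_sub_distrib, Finset.sum_add_distrib, ← Finset.mul_sum,
      ← Finset.sum_mul]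
    ring
  linarith

theorem IsResolution.antitone_pow_mul {p : ℕ} {ω : ℝ≥0} {γ : ℕ → ℝ≥0} (h : IsResolution p ω γ) :
    Antitone fun i => ((p : ℝ) ^ i * γ i) := by
  refine antitone_nat_of_succ_le fun i => ?_
  have h1 : (p : ℝ) * γ (i + 1) ≤ γ i := by exact_mod_cast h.step i
  calc (p : ℝ) ^ (i + 1) * γ (i + 1) = (p : ℝ) ^ i * (p * γ (i + 1)) := by ring
    _ ≤ (p : ℝ) ^ i * γ i := by gcongr

theorem mul_le_invGeomSum_mul_sum {s t : ℕ} {γ δ : ℕ → ℝ≥0} (hγ : IsResolution p s γ)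
    (hδ : IsResolution p t δ) {M : ℕ} (hs : maxLength p s ≤ M) (ht : maxLength p t ≤ M) :
    (s : ℝ≥0) * t ≤ invGeomSum p M * ∑ i ∈ Finset.range M, (p : ℝ≥0) ^ i * γ i * δ i := by
  have hp0 : (p : ℝ) ≠ 0 := by exact_mod_cast hp.out.ne_zero
  have key := sum_mul_sum_le_of_antitone (w := fun i => ((p : ℝ) ^ i)⁻¹) (fun i => by positivity)
    hγ.antitone_pow_mul hδ.antitone_pow_mul (Finset.range M)
  have e1 : ∀ (ε : ℕ → ℝ≥0) (i : ℕ), ((p : ℝ) ^ i)⁻¹ * ((p : ℝ) ^ i * ε i) = ε i :=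
    fun ε i => inv_mul_cancel_left₀ (pow_ne_zero i hp0) _
  have e2 : ∀ i, ((p : ℝ) ^ i)⁻¹ * ((p : ℝ) ^ i * γ i * ((p : ℝ) ^ i * δ i)) =
      (p : ℝ) ^ i * γ i * δ i := fun i => by field_simp
  simp only [e1, e2] at key
  rw [← hγ.sum_range_eq hs, ← hδ.sum_range_eq ht, ← NNReal.coe_le_coe]
  push_cast [invGeomSum]
  exact key

theorem geomResolution_pairing_mul {s t : ℕ} (hst : maxLength p t ≤ maxLength p s) :
    (∑ i ∈ Finset.range (maxLength p s),
      (p : ℝ≥0) ^ i * geomResolution p s i * geomResolution p t i) *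
        invGeomSum p (maxLength p s) ≤ s * t := by
  have hp0 : (p : ℝ≥0) ≠ 0 := by exact_mod_cast hp.out.ne_zero
  rcases eq_or_ne s 0 with rfl | hs
  · simp [geomResolution]
  have hD := (invGeomSum_pos p (maxLength_ne_zero p hs)).ne'
  have h : ∀ i ∈ Finset.range (maxLength p s),
      (p : ℝ≥0) ^ i * geomResolution p s i * geomResolution p t i =
        s / invGeomSum p (maxLength p s) * geomResolution p t i := fun i hi => by
    rw [geomResolution, if_pos (Finset.mem_range.1 hi)]
    field_simp
  rw [Finset.sum_congr rfl h, ← Finset.mul_sum,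
    (isResolution_geomResolution p t).sum_range_eq hst]
  apply le_of_eq
  field_simp

/-- The pairing of minimal real resolutions is at most the pairing of any two resolutions. -/
theorem geomResolution_pairing_le {s t : ℕ} {γ δ : ℕ → ℝ≥0} (hγ : IsResolution p s γ)
    (hδ : IsResolution p t δ) :
    ∑' i : ℕ, (p : ℝ≥0∞) ^ i * (geomResolution p s i : ℝ≥0∞) * (geomResolution p t i : ℝ≥0∞) ≤
      ∑' i : ℕ, (p : ℝ≥0∞) ^ i * (γ i : ℝ≥0∞) * (δ i : ℝ≥0∞) := by
  wlog hst : maxLength p t ≤ maxLength p s generalizing s t γ δ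
  · simpa only [mul_right_comm] using this hδ hγ (le_of_not_ge hst)
  rw [tsum_eq_sum (s := Finset.range (maxLength p s)) fun i hi => by
    simp [geomResolution, show ¬ i < maxLength p s by simpa using hi]]
  refine le_trans ?_ (ENNReal.sum_le_tsum (Finset.range (maxLength p s)))
  have h : ∑ i ∈ Finset.range (maxLength p s),
      (p : ℝ≥0) ^ i * geomResolution p s i * geomResolution p t i ≤
        ∑ i ∈ Finset.range (maxLength p s), (p : ℝ≥0) ^ i * γ i * δ i := by
    rcases eq_or_ne s 0 with rfl | hs
    · simp [geomResolution]
    refine le_of_mul_le_mul_right ?_ (invGeomSum_pos p (maxLength_ne_zero p hs))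
    refine (geomResolution_pairing_mul p hst).trans ?_
    rw [mul_comm _ (invGeomSum _ _)]
    exact mul_le_invGeomSum_mul_sum p hγ hδ le_rfl hst
  exact_mod_cast h

theorem minimalResolution_pairing_le (s t : ℕ) :
    ∑' i : ℕ, (p : ℝ≥0∞) ^ i *
        (minimalResolution p s i : ℝ≥0∞) * (minimalResolution p t i : ℝ≥0∞) ≤
      greedyPairing p s t := by
  rw [minimalResolution_eq_geomResolution, minimalResolution_eq_geomResolution]
  simpa [greedyPairing] using geomResolution_pairing_le p
    (isIntegralResolution_greedy p s).toIsResolution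
    (isIntegralResolution_greedy p t).toIsResolution

end RealResolution

/-! ### Sums over the tree of residue classes -/

/-- The sum of `a i c * b i c` over the first `k` generations of descendants of the class of `c`
modulo `p ^ i`. The class of `c + p ^ i * j` modulo `p ^ (i + 1)`, for `j < p`, is a child of it,
and carries the value of `a i` and `b i`. -/
def treeSum {R : Type*} [Semiring R] (p : ℕ) (a b : ℕ → ℤ → R) : ℕ → ℕ → ℤ → R
  | 0, _, _ => 0
  | k + 1, i, c => ∑ j ∈ Finset.range p, (a i (c + p ^ i * j) * b i (c + p ^ i * j) +
      treeSum p a b k (i + 1) (c + p ^ i * j))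

theorem treeSum_comm {R : Type*} [CommSemiring R] (p : ℕ) (a b : ℕ → ℤ → R) (k i : ℕ) (c : ℤ) :
    treeSum p a b k i c = treeSum p b a k i c := by
  induction k generalizing i c with
  | zero => rfl
  | succ k ih => simp only [treeSum, ih, mul_comm (a i _)]

theorem map_treeSum {R S : Type*} [Semiring R] [Semiring S] (φ : R →+* S) (p : ℕ)
    (a b : ℕ → ℤ → R) (k i : ℕ) (c : ℤ) :
    φ (treeSum p a b k i c) =
      treeSum p (fun i c => φ (a i c)) (fun i c => φ (b i c)) k i c := by
  induction k generalizing i c with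
  | zero => exact map_zero φ
  | succ k ih => simp only [treeSum, map_sum, map_add, map_mul, ih]

theorem treeSum_multiset_sum_left {R ι : Type*} [Semiring R] (p : ℕ) (A : Multiset ι)
    (a : ι → ℕ → ℤ → R) (b : ℕ → ℤ → R) (k i : ℕ) (c : ℤ) :
    treeSum p (fun i c => (A.map fun α => a α i c).sum) b k i c =
      (A.map fun α => treeSum p (a α) b k i c).sum := by
  induction k generalizing i c with
  | zero => simp [treeSum]
  | succ k ih =>
    simp only [treeSum, ih]
    rw [Multiset.sum_map_sum]
    simp only [Multiset.sum_map_add, Multiset.sum_map_mul_right]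

theorem treeSum_multiset_sum_right {R ι : Type*} [CommSemiring R] (p : ℕ) (B : Multiset ι)
    (a : ℕ → ℤ → R) (b : ι → ℕ → ℤ → R) (k i : ℕ) (c : ℤ) :
    treeSum p a (fun i c => (B.map fun β => b β i c).sum) k i c =
      (B.map fun β => treeSum p a (b β) k i c).sum := by
  rw [treeSum_comm, treeSum_multiset_sum_left]
  exact congrArg _ (Multiset.map_congr rfl fun β _ => treeSum_comm p _ _ k i c)

/-- A non-negative integral weight on the edges of the tree of residue classes modulo powers of `p`,
given by its sums `w i c` along the paths from the root to the class of `c` modulo `p ^ i`. The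
weight of an edge is at least the sum of the weights of the edges below it, and the sums reach
`s` at depth `s`. -/
structure IsTreeWeight (p s : ℕ) (w : ℕ → ℤ → ℕ) : Prop where
  zero : ∀ c, w 0 c = 0
  congr : ∀ i c (j : ℕ), w i (c + p ^ i * j) = w i c
  mono : ∀ i c, w i c ≤ w (i + 1) c
  sum_le : ∀ i c, ∑ j ∈ Finset.range p,
    (w (i + 2) (c + p ^ (i + 1) * j) - w (i + 1) (c + p ^ (i + 1) * j)) ≤ w (i + 1) c - w i c
  le : ∀ i c, s ≤ i → s ≤ w i c

namespace IsTreeWeight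

variable {p s t : ℕ} [hp : Fact p.Prime] {w u : ℕ → ℤ → ℕ}

/-- Following the lightest edge downwards from a given one gives an integral resolution, whose
total is bounded in terms of its first term. -/
theorem sub_le_maxTotal (hw : IsTreeWeight p s w) (i : ℕ) (c : ℤ) :
    s - w i c ≤ maxTotal p (w (i + 1) c - w i c) := by
  rcases le_total s i with hi | hi
  · have := hw.le i c hi
    omega
  obtain ⟨k, rfl⟩ : ∃ k, s = i + k := Nat.exists_eq_add_of_le hi
  clear hi
  induction k generalizing i c with
  | zero =>
    have := hw.le i c (by omega)
    omega
  | succ k ih =>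
    obtain ⟨j, -, hjmin⟩ := Finset.exists_min_image (Finset.range p)
      (fun j : ℕ => w (i + 2) (c + p ^ (i + 1) * j) - w (i + 1) (c + p ^ (i + 1) * j))
      ⟨0, Finset.mem_range.2 hp.out.pos⟩
    have h1 := (Finset.card_nsmul_le_sum _ _ _ hjmin).trans (hw.sum_le i c)
    rw [Finset.card_range, smul_eq_mul] at h1
    have h2 := ih (i + 1) (c + p ^ (i + 1) * j) (by rwa [show i + 1 + k = i + (k + 1) by omega])
    have h3 := maxTotal_mono p ((Nat.le_div_iff_mul_le hp.out.pos).2 ((mul_comm _ _).trans_le h1))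
    have h4 := hw.mono i c
    rw [maxTotal_eq]
    rw [hw.congr (i + 1)] at h2
    simp only [hw.congr (i + 1)] at h3
    have h5 : i + 1 + 1 = i + 2 := rfl
    rw [h5] at h2
    omega

theorem firstTerm_le (hw : IsTreeWeight p s w) (i : ℕ) (c : ℤ) :
    firstTerm p (s - w i c) ≤ w (i + 1) c - w i c :=
  (firstTerm_le_iff p).2 (hw.sub_le_maxTotal i c)

theorem le_treeSum (hw : IsTreeWeight p s w) (hu : IsTreeWeight p t u) (k i : ℕ) (c : ℤ)
    (hk : s ≤ i + k) :
    p * greedyPairing p (s - w i c) (t - u i c) ≤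
      (treeSum p (fun i c => w (i + 1) c - w i c) (fun i c => u (i + 1) c - u i c) k i c : ℕ) := by
  induction k generalizing i c with
  | zero =>
    have := hw.le i c hk
    rw [Nat.sub_eq_zero_of_le this, greedyPairing_zero_left]
    simp
  | succ k ih =>
    rw [treeSum, Nat.cast_sum]
    calc (p : ℝ≥0∞) * greedyPairing p (s - w i c) (t - u i c)
        = ∑ j ∈ Finset.range p, greedyPairing p (s - w i c) (t - u i c) := by simp
      _ ≤ _ := Finset.sum_le_sum fun j _ => ?_
    rw [← hw.congr i c j, ← hu.congr i c j]
    generalize c + (p : ℤ) ^ i * j = d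
    refine (greedyPairing_le_of_firstTerm_le p (hw.firstTerm_le i d) (hu.firstTerm_le i d)).trans ?_
    have hw' := hw.mono i d
    have hu' := hu.mono i d
    rw [show s - w i d - (w (i + 1) d - w i d) = s - w (i + 1) d by omega,
      show t - u i d - (u (i + 1) d - u i d) = t - u (i + 1) d by omega, Nat.cast_add, Nat.cast_mul]
    gcongr
    exact ih _ _ (by omega)

/-- The total over the tree is smallest for weights that are constant on each level. -/
theorem mul_greedyPairing_le_treeSum (hw : IsTreeWeight p s w) (hu : IsTreeWeight p t u) :
    p * greedyPairing p s t ≤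
      (treeSum p (fun i c => w (i + 1) c - w i c) (fun i c => u (i + 1) c - u i c) s 0 0 : ℕ) := by
  simpa [hw.zero, hu.zero] using hw.le_treeSum hu s 0 0 (by omega)

end IsTreeWeight

/-! ### Truncated valuations -/

/-- The valuation of an element of norm `r`, truncated at `i`. The maximum with
`p ^ (-i)` keeps the logarithm meaningful for `r = 0`. -/
noncomputable def truncVal (p i : ℕ) (r : ℝ) : ℝ := -Real.logb p (max r ((p : ℝ) ^ i)⁻¹)

/-- The part of the valuation of an element of norm `r` that lies between `i` and `i + 1`. -/
noncomputable def edgeVal (p i : ℕ) (r : ℝ) : ℝ := truncVal p (i + 1) r - truncVal p i r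

section TruncVal

variable (p : ℕ) [hp : Fact p.Prime]

omit hp in
theorem truncVal_eq_of_le {i : ℕ} {r : ℝ} (h : r ≤ ((p : ℝ) ^ i)⁻¹) :
    truncVal p i r = truncVal p i 0 := by
  rw [truncVal, truncVal, max_eq_right h, max_eq_right (by positivity)]

theorem truncVal_zero_right (i : ℕ) : truncVal p i 0 = i := by
  have hp1 : (1 : ℝ) < p := by exact_mod_cast hp.out.one_lt
  rw [truncVal, max_eq_right (by positivity), Real.logb_inv, neg_neg, Real.logb_pow,
    Real.logb_self_eq_one hp1, mul_one]

theorem truncVal_antitone (i : ℕ) : Antitone (truncVal p i) := fun r s h => by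
  have hp1 : (1 : ℝ) < p := by exact_mod_cast hp.out.one_lt
  rw [truncVal, truncVal]
  gcongr

theorem truncVal_le (i : ℕ) {r : ℝ} (hr : 0 < r) : truncVal p i r ≤ -Real.logb p r := by
  have hp1 : (1 : ℝ) < p := by exact_mod_cast hp.out.one_lt
  rw [truncVal]
  gcongr
  exact le_max_left _ _

theorem inv_pow_succ_lt (i : ℕ) : ((p : ℝ) ^ (i + 1))⁻¹ < ((p : ℝ) ^ i)⁻¹ := by
  have hp1 : (1 : ℝ) < p := by exact_mod_cast hp.out.one_lt
  gcongr
  omega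

theorem edgeVal_eq_zero {i : ℕ} {r : ℝ} (h : ((p : ℝ) ^ i)⁻¹ ≤ r) : edgeVal p i r = 0 := by
  rw [edgeVal, truncVal, truncVal, max_eq_left h, max_eq_left ((inv_pow_succ_lt p i).le.trans h),
    sub_self]

theorem edgeVal_eq_one {i : ℕ} {r : ℝ} (h : r ≤ ((p : ℝ) ^ (i + 1))⁻¹) : edgeVal p i r = 1 := by
  rw [edgeVal, truncVal_eq_of_le p h, truncVal_eq_of_le p (h.trans ((inv_pow_succ_lt p i).le)),
    truncVal_zero_right, truncVal_zero_right]
  push_cast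
  ring

theorem edgeVal_antitone (i : ℕ) : Antitone (edgeVal p i) := fun r s h => by
  rcases le_total s ((p : ℝ) ^ i)⁻¹ with hs | hs
  · rw [edgeVal, edgeVal, truncVal_eq_of_le p hs, truncVal_eq_of_le p (h.trans hs)]
    have := truncVal_antitone p (i + 1) h
    linarith
  · have hp1 : (1 : ℝ) < p := by exact_mod_cast hp.out.one_lt
    rw [edgeVal_eq_zero p hs, edgeVal, truncVal, truncVal, sub_nonneg]
    have := (inv_pow_succ_lt p i).le
    gcongr

theorem edgeVal_nonneg (i : ℕ) (r : ℝ) : 0 ≤ edgeVal p i r :=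
  (edgeVal_eq_zero p (le_max_right r _)).ge.trans (edgeVal_antitone p i (le_max_left r _))

theorem edgeVal_le_one (i : ℕ) (r : ℝ) : edgeVal p i r ≤ 1 :=
  (edgeVal_antitone p i (min_le_left r _)).trans (edgeVal_eq_one p (min_le_right r _)).le

end TruncVal

/-! ### The contribution of a pair of roots -/

section Roots

-- `L` is a field with an absolute value that extends the `p`-adic one on `ℤ`, which the hypothesis
-- `hL` of the lemmas below expresses; the final proof takes the algebraic closure of `ℚ_[p]`.

variable {p : ℕ} [hp : Fact p.Prime] {L : Type*} [NormedField L]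

theorem norm_intCast_le_one (hL : ∀ z : ℤ, ‖(z : L)‖ = ‖(z : ℚ_[p])‖) (z : ℤ) : ‖(z : L)‖ ≤ 1 :=
  (hL z).trans_le (Padic.norm_int_le_one z)

theorem norm_pow_mul_intCast (hL : ∀ z : ℤ, ‖(z : L)‖ = ‖(z : ℚ_[p])‖) (i : ℕ) (z : ℤ) :
    ‖(p : L) ^ i * z‖ = ((p : ℝ) ^ i)⁻¹ * ‖(z : L)‖ := by
  have := hL p
  rw [Int.cast_natCast, Int.cast_natCast, Padic.norm_p] at this
  rw [norm_mul, norm_pow, this, inv_pow]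

theorem norm_intCast_of_emultiplicity (hL : ∀ z : ℤ, ‖(z : L)‖ = ‖(z : ℚ_[p])‖) {z : ℤ} {m : ℕ}
    (h : emultiplicity (p : ℤ) z = m) : ‖(z : L)‖ = ((p : ℝ) ^ m)⁻¹ := by
  obtain ⟨⟨u, rfl⟩, h2⟩ := emultiplicity_eq_coe.1 h
  have hu : ¬ (p : ℤ) ∣ u := fun ⟨t, ht⟩ => h2 ⟨t, by rw [ht]; ring⟩
  have hu1 : ‖(u : L)‖ = 1 := (norm_intCast_le_one hL u).eq_of_not_lt fun hlt =>
    hu (Padic.norm_intCast_lt_one_iff.1 (by rwa [← hL]))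
  have := norm_pow_mul_intCast hL m u
  rw [hu1, mul_one] at this
  rw [← this]
  push_cast
  rfl

theorem exists_norm_intCast_eq (hL : ∀ z : ℤ, ‖(z : L)‖ = ‖(z : ℚ_[p])‖) {z : ℤ} (hz : z ≠ 0) :
    ∃ m : ℕ, ‖(z : L)‖ = ((p : ℝ) ^ m)⁻¹ := by
  have hfin : FiniteMultiplicity (p : ℤ) z := Int.finiteMultiplicity_iff.2
    ⟨by simpa using hp.out.ne_one, hz⟩
  exact ⟨_, norm_intCast_of_emultiplicity hL hfin.emultiplicity_eq_multiplicity⟩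

theorem norm_intCast_le_of_le_vp (hL : ∀ z : ℤ, ‖(z : L)‖ = ‖(z : ℚ_[p])‖) {z : ℤ} {s : ℕ}
    (h : (s : ℕ∞) ≤ vp p z) : ‖(z : L)‖ ≤ ((p : ℝ) ^ s)⁻¹ := by
  obtain ⟨u, rfl⟩ := pow_dvd_of_le_emultiplicity h
  push_cast
  rw [norm_pow_mul_intCast hL]
  exact mul_le_of_le_one_right (by positivity) (norm_intCast_le_one hL u)

/-- The function on the edges of the tree of residue classes attached to a root `α`: the class of
`c` modulo `p ^ (i + 1)` carries the part between `i` and `i + 1` of the valuation of `α - c`. -/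
noncomputable def rootWeight (p : ℕ) (α : L) (i : ℕ) (c : ℤ) : ℝ := edgeVal p i ‖α - c‖

theorem norm_pow_mul_le (hL : ∀ z : ℤ, ‖(z : L)‖ = ‖(z : ℚ_[p])‖) (c : ℤ) (i j : ℕ) :
    ‖((c + p ^ i * j : ℤ) : L) - c‖ ≤ ((p : ℝ) ^ i)⁻¹ := by
  have h := norm_pow_mul_intCast hL i j
  push_cast at h ⊢
  rw [add_sub_cancel_left, h]
  exact mul_le_of_le_one_right (by positivity) (by simpa using norm_intCast_le_one hL j)

variable [IsUltrametricDist L]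

theorem norm_sub_le_of_norm_sub_le {x y z : L} {r : ℝ} (h1 : ‖x - z‖ ≤ r) (h2 : ‖y - z‖ ≤ r) :
    ‖x - y‖ ≤ r := by
  rw [← dist_eq_norm] at h1 h2 ⊢
  rw [dist_comm y] at h2
  exact (dist_triangle_max x z y).trans (max_le h1 h2)

theorem truncVal_norm_add_pow_mul (hL : ∀ z : ℤ, ‖(z : L)‖ = ‖(z : ℚ_[p])‖) (α : L) (i j : ℕ)
    (c : ℤ) : truncVal p i ‖α - (c + p ^ i * j : ℤ)‖ = truncVal p i ‖α - c‖ := by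
  have h := norm_pow_mul_le hL c i j
  rw [truncVal, truncVal]
  congr 2
  refine le_antisymm (max_le ?_ (le_max_right _ _)) (max_le ?_ (le_max_right _ _))
  · refine norm_sub_le_of_norm_sub_le (le_max_left _ _) ?_
    exact h.trans (le_max_right _ _)
  · refine norm_sub_le_of_norm_sub_le (le_max_left _ _) ?_
    rw [norm_sub_rev]
    exact h.trans (le_max_right _ _)

/-- A root is strictly close to at most one of the `p` children of a residue class. -/
theorem eq_of_norm_sub_lt (hL : ∀ z : ℤ, ‖(z : L)‖ = ‖(z : ℚ_[p])‖) {α : L} {i j j' : ℕ} {c : ℤ}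
    (hj : j < p) (hj' : j' < p) (h : ‖α - (c + p ^ i * j : ℤ)‖ < ((p : ℝ) ^ i)⁻¹)
    (h' : ‖α - (c + p ^ i * j' : ℤ)‖ < ((p : ℝ) ^ i)⁻¹) : j = j' := by
  have h1 : ‖((c + p ^ i * j' : ℤ) : L) - (c + p ^ i * j : ℤ)‖ ≤ _ :=
    norm_sub_le_of_norm_sub_le (z := α) ((norm_sub_rev _ _).trans_le (le_max_right _ _))
      ((norm_sub_rev _ _).trans_le (le_max_left _ _))
  have h2 := h1.trans_lt (max_lt h h')
  have h3 : ((c + p ^ i * j' : ℤ) : L) - (c + p ^ i * j : ℤ) =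
      (p : L) ^ i * ((j' - j : ℤ) : L) := by push_cast; ring
  have hp0 : (0 : ℝ) < p := by exact_mod_cast hp.out.pos
  rw [h3, norm_pow_mul_intCast hL, mul_lt_iff_lt_one_right (by positivity), hL,
    Padic.norm_intCast_lt_one_iff] at h2
  have h4 := Int.eq_zero_of_abs_lt_dvd h2 (by rw [abs_lt]; omega)
  omega

/-- A sum over the children of a residue class that is supported on the children close to `α` has
at most one term. -/
theorem sum_range_le_of_support (hL : ∀ z : ℤ, ‖(z : L)‖ = ‖(z : ℚ_[p])‖) {α : L} {i : ℕ} {c : ℤ}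
    {F : ℕ → ℝ} {B : ℝ} (hB : 0 ≤ B)
    (hF : ∀ j : ℕ, ((p : ℝ) ^ i)⁻¹ ≤ ‖α - (c + p ^ i * j : ℤ)‖ → F j = 0) (hFB : ∀ j, F j ≤ B) :
    ∑ j ∈ Finset.range p, F j ≤ B := by
  by_cases h : ∃ j : ℕ, j ∈ Finset.range p ∧ ‖α - (c + p ^ i * j : ℤ)‖ < ((p : ℝ) ^ i)⁻¹
  · obtain ⟨j, hj, hlt⟩ := h
    rw [Finset.sum_eq_single_of_mem j hj fun j' hj' hne => hF j' (not_lt.1 fun hlt' => hne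
      (eq_of_norm_sub_lt hL (Finset.mem_range.1 hj') (Finset.mem_range.1 hj) hlt' hlt))]
    exact hFB j
  · push Not at h
    rwa [Finset.sum_eq_zero fun j hj => hF j (h j hj)]

theorem sum_rootWeight_le (hL : ∀ z : ℤ, ‖(z : L)‖ = ‖(z : ℚ_[p])‖) (α : L) (i : ℕ) (c : ℤ) :
    ∑ j ∈ Finset.range p, rootWeight p α (i + 1) (c + p ^ (i + 1) * j) ≤ rootWeight p α i c := by
  by_cases h : ‖α - c‖ ≤ ((p : ℝ) ^ (i + 1))⁻¹
  · rw [rootWeight, edgeVal_eq_one p h]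
    exact sum_range_le_of_support hL zero_le_one (fun j hj => edgeVal_eq_zero p hj)
      fun j => edgeVal_le_one p _ _
  · rw [Finset.sum_eq_zero]
    · exact edgeVal_nonneg p _ _
    · intro j _
      refine edgeVal_eq_zero p (le_of_not_gt fun hlt => h ?_)
      refine norm_sub_le_of_norm_sub_le hlt.le ?_
      rw [norm_sub_rev]
      exact norm_pow_mul_le hL c (i + 1) j

theorem treeSum_rootWeight_eq_zero (hL : ∀ z : ℤ, ‖(z : L)‖ = ‖(z : ℚ_[p])‖) {α : L}
    (b : ℕ → ℤ → ℝ) (k : ℕ) {i : ℕ} {c : ℤ} (h : ((p : ℝ) ^ i)⁻¹ < ‖α - c‖) :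
    treeSum p (rootWeight p α) b k i c = 0 := by
  induction k generalizing i c with
  | zero => rfl
  | succ k ih =>
    refine Finset.sum_eq_zero fun j _ => ?_
    have h1 : ((p : ℝ) ^ i)⁻¹ < ‖α - (c + p ^ i * j : ℤ)‖ := by
      by_contra hle
      refine h.not_ge (norm_sub_le_of_norm_sub_le (not_lt.1 hle) ?_)
      rw [norm_sub_rev]
      exact norm_pow_mul_le hL c i j
    rw [rootWeight, edgeVal_eq_zero p h1.le, zero_mul, zero_add]
    exact ih ((inv_pow_succ_lt p i).trans h1)

/-- The edges that carry positive weight for both `α` and `β` lie on a single path, and on each of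
them the product of the two weights is at most the part of the valuation of `α - β` belonging to
that level. -/
theorem treeSum_rootWeight_le (hL : ∀ z : ℤ, ‖(z : L)‖ = ‖(z : ℚ_[p])‖) (α β : L) (k i : ℕ)
    (c : ℤ) : treeSum p (rootWeight p α) (rootWeight p β) k i c ≤
      truncVal p (i + k) ‖α - β‖ - truncVal p i ‖α - β‖ := by
  induction k generalizing i c with
  | zero => simp [treeSum]
  | succ k ih =>
    have hstep : truncVal p (i + (k + 1)) ‖α - β‖ - truncVal p i ‖α - β‖ =
        edgeVal p i ‖α - β‖ + (truncVal p (i + 1 + k) ‖α - β‖ - truncVal p (i + 1) ‖α - β‖) := by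
      rw [edgeVal, show i + (k + 1) = i + 1 + k by omega]
      ring
    rw [hstep]
    refine sum_range_le_of_support (α := α) (i := i) (c := c) hL ?_ (fun j hj => ?_) fun j => ?_
    · have hmono : ∀ n : ℕ, truncVal p (i + 1) ‖α - β‖ ≤ truncVal p (i + 1 + n) ‖α - β‖ := by
        intro n
        induction n with
        | zero => exact le_rfl
        | succ n ihn => exact ihn.trans (sub_nonneg.1 (edgeVal_nonneg p _ _))
      exact add_nonneg (edgeVal_nonneg p _ _) (sub_nonneg.2 (hmono k))
    · rw [treeSum_rootWeight_eq_zero hL _ k ((inv_pow_succ_lt p i).trans_le hj), rootWeight,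
        edgeVal_eq_zero p hj, zero_mul, zero_add]
    · refine add_le_add ?_ (ih _ _)
      generalize c + (p : ℤ) ^ i * j = d
      have hmax : ‖α - β‖ ≤ max ‖α - d‖ ‖β - d‖ :=
        norm_sub_le_of_norm_sub_le (le_max_left _ _) (le_max_right _ _)
      refine le_trans ?_ (edgeVal_antitone p i hmax)
      rcases le_total ‖α - d‖ ‖β - d‖ with h | h
      · rw [max_eq_right h]
        exact mul_le_of_le_one_left (edgeVal_nonneg p _ _) (edgeVal_le_one p _ _)
      · rw [max_eq_left h]
        exact mul_le_of_le_one_right (edgeVal_nonneg p _ _) (edgeVal_le_one p _ _)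

end Roots

/-! ### The tree weight of a monic polynomial -/

section GaussNorm

variable {p : ℕ} [hp : Fact p.Prime] {L : Type*} [NormedField L] [IsUltrametricDist L]

/-- The Gauss norm on `L[X]` in which `X` has norm `p ^ (-i)`. -/
noncomputable def gaussNormAt (p i : ℕ) (F : L[X]) : ℝ :=
  F.gaussNorm (IsAbsoluteValue.toAbsoluteValue (norm : L → ℝ)) ((p : ℝ) ^ i)⁻¹

omit hp [IsUltrametricDist L] in
theorem norm_coeff_mul_le_gaussNormAt (i : ℕ) (F : L[X]) (j : ℕ) :
    ‖F.coeff j‖ * (((p : ℝ) ^ i)⁻¹) ^ j ≤ gaussNormAt p i F :=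
  le_gaussNorm (IsAbsoluteValue.toAbsoluteValue (norm : L → ℝ)) F (by positivity) j

omit hp [IsUltrametricDist L] in
theorem exists_gaussNormAt_eq (i : ℕ) (F : L[X]) :
    ∃ j, gaussNormAt p i F = ‖F.coeff j‖ * (((p : ℝ) ^ i)⁻¹) ^ j :=
  exists_eq_gaussNorm (IsAbsoluteValue.toAbsoluteValue (norm : L → ℝ)) _ F

theorem isNonarchimedean_toAbsoluteValue :
    IsNonarchimedean (IsAbsoluteValue.toAbsoluteValue (norm : L → ℝ)) :=
  fun x y => IsUltrametricDist.isNonarchimedean_norm x y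

theorem gaussNormAt_mul (i : ℕ) (F G : L[X]) :
    gaussNormAt p i (F * G) = gaussNormAt p i F * gaussNormAt p i G :=
  gaussNorm_mul isNonarchimedean_toAbsoluteValue
    (inv_pos.2 (pow_pos (by exact_mod_cast hp.out.pos) i)) F G

omit hp [IsUltrametricDist L] in
theorem gaussNormAt_X_sub_C (i : ℕ) (a : L) :
    gaussNormAt p i (X - C a) = max ‖a‖ ((p : ℝ) ^ i)⁻¹ := by
  refine le_antisymm ?_ (max_le ?_ ?_)
  · obtain ⟨j, hj⟩ := exists_gaussNormAt_eq (p := p) i (X - C a)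
    rw [hj]
    rcases j with _ | _ | j
    · simp
    · simp
    · rw [coeff_sub, coeff_X, coeff_C]
      simp
  · have h := norm_coeff_mul_le_gaussNormAt (p := p) i (X - C a) 0
    rwa [coeff_sub, coeff_X_zero, coeff_C_zero, zero_sub, norm_neg, pow_zero, mul_one] at h
  · have h := norm_coeff_mul_le_gaussNormAt (p := p) i (X - C a) 1
    rwa [coeff_sub, coeff_X_one, coeff_C_of_ne_zero one_ne_zero, sub_zero, norm_one, pow_one,
      one_mul] at h

theorem neg_logb_gaussNormAt_prod (i : ℕ) (A : Multiset L) :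
    0 < gaussNormAt p i (A.map fun a => X - C a).prod ∧
      -Real.logb p (gaussNormAt p i (A.map fun a => X - C a).prod) =
        (A.map fun a => truncVal p i ‖a‖).sum := by
  have hp0 : (0 : ℝ) < p := by exact_mod_cast hp.out.pos
  induction A using Multiset.induction_on with
  | empty =>
    have : gaussNormAt p i (1 : L[X]) = 1 := by
      rw [gaussNormAt, ← C_1, gaussNorm_C, map_one]
    simp [this]
  | cons a A ih =>
    have ha : 0 < max ‖a‖ ((p : ℝ) ^ i)⁻¹ := lt_max_of_lt_right (by positivity)
    rw [Multiset.map_cons, Multiset.prod_cons, gaussNormAt_mul, gaussNormAt_X_sub_C,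
      Multiset.map_cons, Multiset.sum_cons, ← ih.2, Real.logb_mul ha.ne' ih.1.ne', truncVal]
    exact ⟨mul_pos ha ih.1, neg_add _ _⟩

variable (L) in
/-- The multiset of the roots of an integral polynomial in a field `L`. -/
noncomputable abbrev intRoots (f : ℤ[X]) : Multiset L := (f.map (Int.castRingHom L)).roots

variable [IsAlgClosed L]

omit [IsUltrametricDist L] in
theorem map_eq_prod_intRoots {f : ℤ[X]} (hm : f.Monic) :
    f.map (Int.castRingHom L) = ((intRoots L f).map fun α => X - C α).prod :=
  (IsAlgClosed.splits _).eq_prod_roots_of_monic (hm.map _)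

/-- The valuations of `α - c`, truncated at `i` and summed over the roots `α` of `f`, give the
least valuation of a coefficient of `f (c + p ^ i * X)`. -/
theorem sum_truncVal_eq {f : ℤ[X]} (hm : f.Monic) (i : ℕ) (c : ℤ) :
    0 < gaussNormAt p i ((taylor c f).map (Int.castRingHom L)) ∧
    -Real.logb p (gaussNormAt p i ((taylor c f).map (Int.castRingHom L))) =
      ((intRoots L f).map fun α : L => truncVal p i ‖α - c‖).sum := by
  have h : (taylor c f).map (Int.castRingHom L) =
      (((intRoots L f).map fun α => α - (c : L)).map fun a => X - C a).prod := by
    rw [map_taylor, map_eq_prod_intRoots hm, ← taylorAlgHom_apply, map_multiset_prod,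
      Multiset.map_map, Multiset.map_map]
    congr 1
    refine Multiset.map_congr rfl fun α _ => ?_
    simp only [Function.comp_apply, taylorAlgHom_apply, map_sub, taylor_X, taylor_C, eq_intCast]
    ring
  rw [h]
  have := neg_logb_gaussNormAt_prod (p := p) i ((intRoots L f).map fun α => α - (c : L))
  rwa [Multiset.map_map (fun a => truncVal p i ‖a‖)] at this

theorem exists_sum_truncVal_eq_natCast (hL : ∀ z : ℤ, ‖(z : L)‖ = ‖(z : ℚ_[p])‖) {f : ℤ[X]}
    (hm : f.Monic) (i : ℕ) (c : ℤ) :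
    ∃ n : ℕ, (n : ℝ) = ((intRoots L f).map fun α : L => truncVal p i ‖α - c‖).sum := by
  have hp1 : (1 : ℝ) < p := by exact_mod_cast hp.out.one_lt
  obtain ⟨hpos, h⟩ := sum_truncVal_eq (p := p) (L := L) hm i c
  rw [← h]
  obtain ⟨j, hj⟩ := exists_gaussNormAt_eq (p := p) i ((taylor c f).map (Int.castRingHom L))
  rw [coeff_map, eq_intCast] at hj
  have hz : (taylor c f).coeff j ≠ 0 := by
    intro h0
    rw [hj, h0] at hpos
    simp at hpos
  obtain ⟨m, hm⟩ := exists_norm_intCast_eq hL hz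
  refine ⟨m + i * j, ?_⟩
  rw [hj, hm, inv_pow, ← mul_inv, ← pow_mul, ← pow_add, Real.logb_inv, neg_neg, Real.logb_pow,
    Real.logb_self_eq_one hp1, mul_one]

/-- In `f (c + p ^ i * X)` the constant coefficient `f c` is divisible by `p ^ s`, and the others
are divisible by `p ^ i`. -/
theorem le_sum_truncVal (hL : ∀ z : ℤ, ‖(z : L)‖ = ‖(z : ℚ_[p])‖) {f : ℤ[X]}
    (hm : f.Monic) {s i : ℕ} (hi : s ≤ i) {c : ℤ} (hs : (s : ℕ∞) ≤ vp p (f.eval c)) :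
    (s : ℝ) ≤ ((intRoots L f).map fun α : L => truncVal p i ‖α - c‖).sum := by
  have hp1 : (1 : ℝ) < p := by exact_mod_cast hp.out.one_lt
  obtain ⟨hpos, h⟩ := sum_truncVal_eq (p := p) (L := L) hm i c
  have hle : gaussNormAt p i ((taylor c f).map (Int.castRingHom L)) ≤ ((p : ℝ) ^ s)⁻¹ := by
    obtain ⟨j, hj⟩ := exists_gaussNormAt_eq (p := p) i ((taylor c f).map (Int.castRingHom L))
    rw [hj, coeff_map, eq_intCast]
    rcases j with _ | j
    · rw [pow_zero, mul_one, taylor_coeff_zero]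
      exact norm_intCast_le_of_le_vp hL hs
    · calc ‖(((taylor c f).coeff (j + 1) : ℤ) : L)‖ * (((p : ℝ) ^ i)⁻¹) ^ (j + 1)
          ≤ (((p : ℝ) ^ i)⁻¹) ^ (j + 1) :=
            mul_le_of_le_one_left (by positivity) (norm_intCast_le_one hL _)
        _ ≤ ((p : ℝ) ^ i)⁻¹ := by
            rw [pow_succ]
            exact mul_le_of_le_one_left (by positivity)
              (pow_le_one₀ (by positivity) (inv_le_one_of_one_le₀ (one_le_pow₀ hp1.le)))
        _ ≤ ((p : ℝ) ^ s)⁻¹ := by gcongr; exact hp1.le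
  rw [← h, le_neg, Real.logb_le_iff_le_rpow hp1 hpos, Real.rpow_neg (by positivity),
    Real.rpow_natCast]
  exact hle

/-- As every truncated valuation at `0` is non-positive, this forces all roots to be integral. -/
theorem sum_truncVal_zero_nonneg (hL : ∀ z : ℤ, ‖(z : L)‖ = ‖(z : ℚ_[p])‖) {f : ℤ[X]}
    (hm : f.Monic) (c : ℤ) : 0 ≤ ((intRoots L f).map fun α : L => truncVal p 0 ‖α - c‖).sum := by
  simpa using le_sum_truncVal (p := p) (s := 0) hL hm le_rfl (c := c) (by simp)

theorem truncVal_zero_nonpos (r : ℝ) : truncVal p 0 r ≤ 0 := by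
  have hp1 : (1 : ℝ) < p := by exact_mod_cast hp.out.one_lt
  rw [truncVal, neg_nonpos]
  exact Real.logb_nonneg hp1 (by simp)

omit [IsUltrametricDist L] [IsAlgClosed L] in
theorem sum_map_truncVal_zero_nonpos (A : Multiset L) (c : ℤ) :
    (A.map fun α : L => truncVal p 0 ‖α - c‖).sum ≤ 0 := by
  refine (Multiset.sum_le_card_nsmul _ 0 fun x hx => ?_).trans (smul_zero _).le
  obtain ⟨β, -, rfl⟩ := Multiset.mem_map.1 hx
  exact truncVal_zero_nonpos _

theorem norm_le_one_of_mem_intRoots (hL : ∀ z : ℤ, ‖(z : L)‖ = ‖(z : ℚ_[p])‖) {f : ℤ[X]}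
    (hm : f.Monic) {α : L} (hα : α ∈ intRoots L f) : ‖α‖ ≤ 1 := by
  have hp1 : (1 : ℝ) < p := by exact_mod_cast hp.out.one_lt
  have h := sum_truncVal_zero_nonneg hL hm 0
  obtain ⟨A, hA⟩ := Multiset.exists_cons_of_mem hα
  have hA0 : (A.map fun α : L => truncVal p 0 ‖α - (0 : ℤ)‖).sum ≤ 0 :=
    sum_map_truncVal_zero_nonpos _ _
  rw [hA, Multiset.map_cons, Multiset.sum_cons, Int.cast_zero, sub_zero] at h
  rw [Int.cast_zero] at hA0
  have h1 : 0 ≤ truncVal p 0 ‖α‖ := by linarith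
  rw [truncVal, neg_nonneg, Real.logb_nonpos_iff hp1 (by positivity)] at h1
  exact (le_max_left _ _).trans h1

/-- A monic integral polynomial whose values are all divisible by `p ^ s` gives rise to a tree
weight: the valuations of `α - c` are cut into pieces of length one and added up over all roots
`α`. The sums along paths are integers because they are valuations of Gauss norms of integral
polynomials. -/
theorem exists_isTreeWeight (hL : ∀ z : ℤ, ‖(z : L)‖ = ‖(z : ℚ_[p])‖) {f : ℤ[X]} (hm : f.Monic)
    {s : ℕ} (hs : ∀ n : ℤ, (s : ℕ∞) ≤ vp p (f.eval n)) :
    ∃ w : ℕ → ℤ → ℕ, IsTreeWeight p s w ∧ ∀ i c,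
      ((w (i + 1) c - w i c : ℕ) : ℝ) = ((intRoots L f).map fun α => rootWeight p α i c).sum := by
  choose w hw using fun i c => exists_sum_truncVal_eq_natCast (p := p) hL hm i c
  have hedge : ∀ i c, (w (i + 1) c : ℝ) - w i c =
      ((intRoots L f).map fun α => rootWeight p α i c).sum := fun i c => by
    rw [hw, hw, ← Multiset.sum_map_sub]
    rfl
  have hmono : ∀ i c, w i c ≤ w (i + 1) c := fun i c => by
    have h : (0 : ℝ) ≤ ((intRoots L f).map fun α => rootWeight p α i c).sum :=
      Multiset.sum_nonneg fun x hx => by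
        obtain ⟨β, -, rfl⟩ := Multiset.mem_map.1 hx
        exact edgeVal_nonneg p _ _
    rw [← hedge, sub_nonneg] at h
    exact_mod_cast h
  have hedge' : ∀ i c, ((w (i + 1) c - w i c : ℕ) : ℝ) =
      ((intRoots L f).map fun α => rootWeight p α i c).sum := fun i c => by
    rw [Nat.cast_sub (hmono i c), hedge]
  refine ⟨w, ⟨fun c => ?_, fun i c j => ?_, hmono, fun i c => ?_, fun i c hi => ?_⟩, hedge'⟩
  · have h : (w 0 c : ℝ) ≤ 0 := (hw 0 c).trans_le (sum_map_truncVal_zero_nonpos _ _)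
    exact Nat.le_zero.1 (by exact_mod_cast h)
  · have h : (w i (c + p ^ i * j) : ℝ) = w i c := by
      rw [hw, hw]
      simp only [truncVal_norm_add_pow_mul hL]
    exact_mod_cast h
  · have h : ((∑ j ∈ Finset.range p,
        (w (i + 2) (c + p ^ (i + 1) * j) - w (i + 1) (c + p ^ (i + 1) * j)) : ℕ) : ℝ) ≤
          (w (i + 1) c - w i c : ℕ) := by
      rw [Nat.cast_sum, hedge' i c, Finset.sum_congr rfl fun j _ => hedge' (i + 1) _,
        ← Multiset.sum_map_sum]
      exact Multiset.sum_map_le_sum_map _ _ fun α _ => sum_rootWeight_le hL α i c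
    exact_mod_cast h
  · have h := le_sum_truncVal (p := p) hL hm hi (hs c)
    rw [← hw] at h
    exact_mod_cast h

/-! ### The resultant -/

omit [IsUltrametricDist L] [IsAlgClosed L] in
theorem sum_neg_logb_eq (p : ℕ) (A : Multiset (L × L))
    (hA : (A.map fun x => x.1 - x.2).prod ≠ 0) :
    (A.map fun x => -Real.logb p ‖x.1 - x.2‖).sum =
      -Real.logb p ‖(A.map fun x => x.1 - x.2).prod‖ := by
  induction A using Multiset.induction_on with
  | empty => simp
  | cons a A ih =>
    rw [Multiset.map_cons, Multiset.prod_cons] at hA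
    have h1 := left_ne_zero_of_mul hA
    have h2 := right_ne_zero_of_mul hA
    rw [Multiset.map_cons, Multiset.sum_cons, ih h2, Multiset.map_cons, Multiset.prod_cons,
      norm_mul, Real.logb_mul (norm_ne_zero_iff.2 h1) (norm_ne_zero_iff.2 h2), neg_add]

theorem sum_map_product_eq {ι κ : Type*} (A : Multiset ι) (B : Multiset κ) (F : ι → κ → ℝ) :
    ((A ×ˢ B).map fun x => F x.1 x.2).sum = (A.map fun a => (B.map (F a)).sum).sum := by
  induction A using Multiset.induction_on with
  | empty => simp
  | cons a A ih => simp [Multiset.cons_product, ih]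

/-- The valuation of the resultant is the sum of the valuations of the differences of roots, and
each of these dominates the corresponding sum over the tree. -/
theorem treeSum_sum_rootWeight_le (hL : ∀ z : ℤ, ‖(z : L)‖ = ‖(z : ℚ_[p])‖) {f g : ℤ[X]}
    (hf : f.Monic) (hg : g.Monic) (hr : f.resultant g ≠ 0) (k : ℕ) :
    treeSum p (fun i c => ((intRoots L f).map fun α => rootWeight p α i c).sum)
      (fun i c => ((intRoots L g).map fun β => rootWeight p β i c).sum) k 0 0 ≤
        -Real.logb p ‖((f.resultant g : ℤ) : L)‖ := by
  have hp1 : (1 : ℝ) < p := by exact_mod_cast hp.out.one_lt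
  have hres : ((f.resultant g : ℤ) : L) =
      ((intRoots L f ×ˢ intRoots L g).map fun x => x.1 - x.2).prod := by
    rw [← resultant_eq_prod_roots_sub _ _ (hf.map _) (hg.map _) (IsAlgClosed.splits _)
      (IsAlgClosed.splits _), hf.natDegree_map, hg.natDegree_map, resultant_map_map, eq_intCast]
  have hne : ((intRoots L f ×ˢ intRoots L g).map fun x => x.1 - x.2).prod ≠ 0 := by
    rw [← hres, ← norm_ne_zero_iff, hL, norm_ne_zero_iff]
    exact_mod_cast hr
  rw [hres, ← sum_neg_logb_eq p _ hne, treeSum_multiset_sum_left]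
  simp_rw [treeSum_multiset_sum_right]
  rw [← sum_map_product_eq (intRoots L f) (intRoots L g)
    fun α β => treeSum p (rootWeight p α) (rootWeight p β) k 0 0]
  refine Multiset.sum_map_le_sum_map _ _ fun x hx => ?_
  obtain ⟨hα, hβ⟩ := Multiset.mem_product.1 hx
  have hne' : x.1 - x.2 ≠ 0 := fun h0 => hne
    (Multiset.prod_eq_zero (Multiset.mem_map.2 ⟨x, hx, h0⟩))
  have hle : ‖x.1 - x.2‖ ≤ 1 := norm_sub_le_of_norm_sub_le (z := 0)
    (by simpa using norm_le_one_of_mem_intRoots hL hf hα)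
    (by simpa using norm_le_one_of_mem_intRoots hL hg hβ)
  have h0 : truncVal p 0 ‖x.1 - x.2‖ = 0 := by
    rw [truncVal_eq_of_le p (by simpa using hle), truncVal_zero_right, Nat.cast_zero]
  refine (treeSum_rootWeight_le hL x.1 x.2 k 0 0).trans ?_
  rw [h0, sub_zero]
  exact truncVal_le p _ (norm_pos_iff.2 hne')

theorem mul_greedyPairing_le_vp (hL : ∀ z : ℤ, ‖(z : L)‖ = ‖(z : ℚ_[p])‖) {f g : ℤ[X]}
    (hf : f.Monic) (hg : g.Monic) {s t : ℕ} (hs : ∀ n : ℤ, (s : ℕ∞) ≤ vp p (f.eval n))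
    (ht : ∀ n : ℤ, (t : ℕ∞) ≤ vp p (g.eval n)) :
    p * greedyPairing p s t ≤ ((vp p (f.resultant g) : ℕ∞) : ℝ≥0∞) := by
  have hp1 : (1 : ℝ) < p := by exact_mod_cast hp.out.one_lt
  rcases eq_or_ne (f.resultant g) 0 with hr | hr
  · rw [hr, vp, emultiplicity_zero]
    simp
  obtain ⟨w, hw, hwf⟩ := exists_isTreeWeight hL hf hs
  obtain ⟨u, hu, hug⟩ := exists_isTreeWeight hL hg ht
  refine (hw.mul_greedyPairing_le_treeSum hu).trans ?_
  have hfin : FiniteMultiplicity (p : ℤ) (f.resultant g) := Int.finiteMultiplicity_iff.2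
    ⟨by simpa using hp.out.ne_one, hr⟩
  have hm := hfin.emultiplicity_eq_multiplicity
  have h := treeSum_sum_rootWeight_le hL hf hg hr s
  rw [norm_intCast_of_emultiplicity hL hm, Real.logb_inv, neg_neg, Real.logb_pow,
    Real.logb_self_eq_one hp1, mul_one] at h
  simp_rw [← hwf, ← hug] at h
  have hcast := map_treeSum (Nat.castRingHom ℝ) p (fun i c => w (i + 1) c - w i c)
    (fun i c => u (i + 1) c - u i c) s 0 0
  simp only [Nat.coe_castRingHom] at hcast
  rw [← hcast] at h
  rw [vp, hm]
  exact_mod_cast h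

end GaussNorm

theorem mainTheorem2 (p : ℕ) [Fact p.Prime] (f g : ℤ[X]) (hf : f.Monic) (hg : g.Monic)
    (s₁ s₂ : ℕ) (hs₁ : ∀ n : ℤ, (s₁ : ℕ∞) ≤ vp p (f.eval n))
    (hs₂ : ∀ n : ℤ, (s₂ : ℕ∞) ≤ vp p (g.eval n)) :
    (p : ℝ≥0∞) * ∑' i : ℕ, (p : ℝ≥0∞) ^ i *
        (minimalResolution p s₁ i : ℝ≥0∞) * (minimalResolution p s₂ i : ℝ≥0∞)
      ≤ ((vp p (f.resultant g) : ℕ∞) : ℝ≥0∞) ∧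
    (p : ℝ≥0∞) * ∑' i : ℕ, (p : ℝ≥0∞) ^ i *
        (minimalIntegralResolution p s₁ i : ℝ≥0∞) * (minimalIntegralResolution p s₂ i : ℝ≥0∞)
      ≤ ((vp p (f.resultant g) : ℕ∞) : ℝ≥0∞) := by
  have h := mul_greedyPairing_le_vp (L := PadicAlgCl p) (fun z => by
    rw [← PadicAlgCl.norm_extends]
    simp) hf hg hs₁ hs₂
  refine ⟨(mul_le_mul_right (minimalResolution_pairing_le p s₁ s₂) _).trans h, ?_⟩
  rw [minimalIntegralResolution_eq_greedy, minimalIntegralResolution_eq_greedy]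
  simpa [greedyPairing] using h
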